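/- Let $d\ge 1$ be an integer, let $M>0$, and let $\phi$ be a probability density on $\mathbb{R}^d$ (with respect to Lebesgue measure). Assume - $(H_S)$: $\phi\in\mathcal{C}^3(\mathbb{R}^d)\cap\mathbb{L}^2(\mathbb{R}^d)$; - $(H_{Lip})$: there is $g\in\mathbb{L}^2(\mathbb{R}^d)$ such that $|\phi(x)-\phi(x-\mu)|\le\|\mu\|\,g(x)$ for all $x\in\mathbb{R}^d$ and all $\mu\in[-M,M]^d$, and $\int_{\mathbb{R}^d} g^2(x)\,\phi^{-1}(x)\,dx<+\infty$, where $\|\cdot\|$ is the Euclidean norm. For $(\lambda,\mu)\in[0,1]\times\mathbb{R}^d$ put $f_{\lambda,\mu}=(1-\lambda)\phi+\lambda\phi(\cdot-\mu)$. For $n\ge 1$ let $$\mathcal{M}_n=\Big\{(\lambda,\mu):\ \lambda=\tfrac{i}{\sqrt n},\ i\in\mathbb{N},\ 1\le i\le\sqrt n;\quad \mu^{(j)}=\pm\tfrac{k_j}{\sqrt n},\ k_j\in\mathbb{N},\ 1\le k_j\le M\sqrt n,\ j=1,\dots,d\Big\},$$ and, for a sample $(X_1,\dots,X_n)$ of points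 of $\mathbb{R}^d$, $$\gamma_n(\lambda,\mu)=-\frac2n\sum_{i=1}^n f_{\lambda,\mu}(X_i)+\int_{\mathbb{R}^d} f_{\lambda,\mu}(x)^2\,dx .$$ Then there is a constant $C_1>0$ (depending only on $d$, $M$ and $\phi$) such that for every integer $n\ge 2$ for which $\mathcal{M}_n$ is non-empty (that is, $M\sqrt n\ge 1$), and every measurable choice $(\hat\lambda_n,\hat\mu_n)=(\hat\lambda_n,\hat\mu_n)(X_1,\dots,X_n)$ of a minimizer of $\gamma_n$ over $\mathcal{M}_n$, $$\sup_{(\lambda^\star,\mu^\star)\in(0,1)\times[-M,M]^d}\mathbb{E}_{\lambda^\star,\mu^\star}\Big[(\lambda^\star\|\mu^\star\|)^2\,\|\hat\mu_n-\mu^\star\|^2\Big]\le\frac{C_1\log^2 n}{n},$$ where $\mathbb{E}_{\lambda^\star,\mu^\star}$ is the expectation when $X_1,\dots,X_n$ are i.i.d. with density $f_{\lambda^\star,\mu^\star}$. -/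

import Mathlib

open MeasureTheory

/-- `ℝ^d` with its Euclidean norm and Lebesgue measure. -/
abbrev Eucl (d : ℕ) : Type := EuclideanSpace ℝ (Fin d)

/-- The cube `[-M, M]^d`. -/
def cube (d : ℕ) (M : ℝ) : Set (Eucl d) := {μ | ∀ j, |μ j| ≤ M}

/-- `φ` is a probability density with respect to the Lebesgue measure on `ℝ^d`. -/
structure IsDensity {d : ℕ} (φ : Eucl d → ℝ) : Prop where
  nonneg : ∀ x, 0 ≤ φ x
  integrable : Integrable φ volume
  integral_eq_one : ∫ x, φ x = 1

/-- Assumption `(H_S)`: `φ` belongs to `C³(ℝ^d) ∩ L²(ℝ^d)`. -/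
structure AssumptionHS {d : ℕ} (φ : Eucl d → ℝ) : Prop where
  contDiff : ContDiff ℝ 3 φ
  memLp : MemLp φ 2 volume

/-- Assumption `(H_Lip)` on the cube `[-M, M]^d`. The integral `∫ g² φ⁻¹` is taken in `[0, ∞]`, so
that a point with `φ = 0` and `g ≠ 0` contributes the value `∞`, and one with `φ = g = 0`
contributes `0`. -/
def AssumptionHLip {d : ℕ} (M : ℝ) (φ : Eucl d → ℝ) : Prop :=
  ∃ g : Eucl d → ℝ, MemLp g 2 volume ∧
    (∀ x : Eucl d, ∀ μ ∈ cube d M, |φ x - φ (x - μ)| ≤ ‖μ‖ * g x) ∧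
    ∫⁻ x, ENNReal.ofReal (g x ^ 2) / ENNReal.ofReal (φ x) < ⊤

/-- The contamination mixture `f_{λ,μ} = (1 - λ) φ + λ φ(· - μ)`, with `θ = (λ, μ)`. -/
def mixture {d : ℕ} (φ : Eucl d → ℝ) (θ : ℝ × Eucl d) (x : Eucl d) : ℝ :=
  (1 - θ.1) * φ x + θ.1 * φ (x - θ.2)

/-- The law of an i.i.d. sample `(X_1, …, X_n)` with common density `f_{λ,μ}`. -/
noncomputable def sampleLaw {d : ℕ} (φ : Eucl d → ℝ) (n : ℕ) (θ : ℝ × Eucl d) :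
    Measure (Fin n → Eucl d) :=
  Measure.pi fun _ => volume.withDensity fun x => ENNReal.ofReal (mixture φ θ x)

/-- The grid `M_n` of mesh `1/√n`: `λ = i/√n` with `1 ≤ i ≤ √n`, and each coordinate of `μ` is
`± k/√n` with `1 ≤ k ≤ M √n`. -/
def grid (d : ℕ) (M : ℝ) (n : ℕ) : Set (ℝ × Eucl d) :=
  {θ | (∃ i : ℕ, 1 ≤ i ∧ (i : ℝ) ≤ √(n : ℝ) ∧ θ.1 = i / √(n : ℝ)) ∧
    ∀ j, ∃ k : ℕ, 1 ≤ k ∧ (k : ℝ) ≤ M * √(n : ℝ) ∧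
      (θ.2 j = k / √(n : ℝ) ∨ θ.2 j = -(k / √(n : ℝ)))}

/-- The contrast `γ_n(λ,μ) = -(2/n) ∑ᵢ f_{λ,μ}(X_i) + ‖f_{λ,μ}‖₂²`. -/
noncomputable def contrast {d : ℕ} (φ : Eucl d → ℝ) (n : ℕ) (X : Fin n → Eucl d)
    (θ : ℝ × Eucl d) : ℝ :=
  -(2 / (n : ℝ)) * (∑ i, mixture φ θ (X i)) + ∫ x, mixture φ θ x ^ 2

/-- `T = (λ̂, μ̂)` is a grid estimator: a measurable function of the sample whose value is always a
minimizer of the contrast over the grid (ties are broken in any measurable way). -/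
structure IsGridEstimator {d : ℕ} (φ : Eucl d → ℝ) (M : ℝ) (n : ℕ)
    (T : (Fin n → Eucl d) → ℝ × Eucl d) : Prop where
  measurable : Measurable T
  mem_grid : ∀ X, T X ∈ grid d M n
  minimizes : ∀ X, ∀ θ ∈ grid d M n, contrast φ n X (T X) ≤ contrast φ n X θ

open scoped FourierTransform RealInnerProductSpace ComplexConjugate

/-! ### A weighted Plancherel inequality -/

section Fourier

variable {V : Type*} [NormedAddCommGroup V] [InnerProductSpace ℝ V] [FiniteDimensional ℝ V]
  [MeasurableSpace V] [BorelSpace V]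

/-! Two estimates are multiplied together.

Separation: the squared `L²` distance between `f_θ` and `f_θ'` is at least `c (λ'‖μ'‖)² ‖μ - μ'‖²`.
On the Fourier side the difference is `φ̂(ξ)` times `λ (e^{ia} - 1) - λ' (e^{ib} - 1)`, where `a`
and `b` are the phases of the two translations. Rotating by `e^{-ia/2}` makes the first term purely
imaginary, so the real part no longer sees `λ` and equals `2 λ' sin (b/2) sin ((b - a)/2)`. Near the
origin `|φ̂| ≥ 1/2`, and some ball of frequencies, of radius fixed in advance, keeps both sines
comparable to `‖μ'‖` and `‖μ - μ'‖`. This is `exists_mul_le_integral_mixture_sub_sq`.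

Risk: up to a term free of `θ`, the contrast is the `L²` loss minus twice a centred empirical mean.
As `φ` is bounded, the variance of that mean is dominated by the loss, so a Bernstein-type
exponential bound over the finite grid (`lintegral_loss_le`) costs only `log (card) / n`. The grid
has polynomially many points, one of them with loss `O(1/n)`, so the `L²` risk is `O(log n / n)`.

Dividing the risk by `c` gives the rate `log n / n`, which is below `log² n / n` up to the factor `1
/ log 2`. -/

lemma continuous_fourier {h : V → ℂ} (hh : Integrable h) : Continuous (𝓕 h) :=
  VectorFourier.fourierIntegral_continuous Real.continuous_fourierChar
    (by simpa using continuous_inner) hh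

lemma integral_fourier_mul {f g : V → ℂ} (hf : Integrable f) (hg : Integrable g) :
    ∫ ξ, 𝓕 f ξ * g ξ = ∫ x, f x * 𝓕 g x := by
  simpa using! VectorFourier.integral_fourierIntegral_smul_eq_flip (L := innerₗ V)
    Real.continuous_fourierChar continuous_inner hf hg

lemma fourier_comp_sub (f : V → ℂ) (μ ξ : V) :
    𝓕 (fun x => f (x - μ)) ξ = Complex.exp (↑(-(2 * Real.pi * ⟪μ, ξ⟫)) * Complex.I) * 𝓕 f ξ := by
  have := congrFun (VectorFourier.fourierIntegral_comp_add_right Real.fourierChar volume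
    (innerₗ V) f (-μ)) ξ
  have e : (fun x => f (x - μ)) = f ∘ fun v => v + -μ := by ext; simp [sub_eq_add_neg]
  rw [e]
  refine this.trans ?_
  rw [Circle.smul_def, Real.fourierChar_apply, smul_eq_mul]
  simp [Real.fourier_eq, VectorFourier.fourierIntegral]

lemma conj_fourier_ofReal (h : V → ℝ) (ξ : V) :
    conj (𝓕 (fun x => (h x : ℂ)) ξ) = 𝓕 (fun x => (h (-x) : ℂ)) ξ := by
  have := congrFun (Real.fourierInv_eq_fourier_comp_neg (fun x => (h x : ℂ))) ξ
  rw [← this, Real.fourier_eq', Real.fourierInv_eq', ← integral_conj]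
  congr 1
  ext v
  simp [← Complex.exp_conj, Complex.conj_ofNat]

lemma integrable_gaussian : Integrable fun ξ : V => Real.exp (-Real.pi * ‖ξ‖ ^ 2) := by
  have := (GaussianFourier.integrable_cexp_neg_mul_sq_norm_add (V := V) (b := Real.pi)
    (by simpa using Real.pi_pos) 0 0).re
  refine this.congr (.of_forall fun ξ => ?_)
  have : (-(Real.pi : ℂ) * (‖ξ‖ : ℂ) ^ 2 + 0 * ((⟪(0 : V), ξ⟫ : ℝ) : ℂ)) =
    ((-Real.pi * ‖ξ‖ ^ 2 : ℝ) : ℂ) := by push_cast; ring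
  simp only [this]
  exact Complex.exp_ofReal_re _

lemma integral_gaussian_eq_one : ∫ ξ : V, Real.exp (-Real.pi * ‖ξ‖ ^ 2) = 1 := by
  rw [GaussianFourier.integral_rexp_neg_mul_sq_norm Real.pi_pos, div_self Real.pi_ne_zero,
    Real.one_rpow]

/-- The Gaussian `exp (-π‖ξ‖²)` is its own Fourier transform, and modulation turns into translation.
-/
lemma fourier_gaussian_modulated (x y : V) :
    𝓕 (fun ξ : V => Complex.exp (↑(2 * Real.pi * ⟪x, ξ⟫) * Complex.I) *
      (Real.exp (-Real.pi * ‖ξ‖ ^ 2) : ℂ)) y = (Real.exp (-Real.pi * ‖x - y‖ ^ 2) : ℂ) := by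
  have := fourier_gaussian_innerProductSpace' (b := Real.pi)
    (by simp [Real.pi_pos]) x y
  rw [div_self (by simp [ Real.pi_ne_zero]), Complex.one_cpow, one_mul] at this
  convert this using 2
  · ext ξ
    rw [Complex.ofReal_exp, ← Complex.exp_add]
    congr 1
    push_cast; ring
  · rw [Complex.ofReal_exp]
    congr 1
    have : (Real.pi : ℂ) ≠ 0 := by simp [Real.pi_ne_zero]
    push_cast; field_simp

lemma integrable_fourier_mul_gaussian {h : V → ℂ} (hh : Integrable h) :
    Integrable fun ξ => 𝓕 h ξ * (Real.exp (-Real.pi * ‖ξ‖ ^ 2) : ℂ) :=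
  integrable_gaussian.ofReal.bdd_mul (c := ∫ x, ‖h x‖)
    (continuous_fourier hh).aestronglyMeasurable
    (.of_forall fun _ => VectorFourier.norm_fourierIntegral_le_integral_norm _ _ _ _ _)

lemma integrable_norm_sq_fourier_mul_gaussian {h : V → ℂ} (hh : Integrable h) :
    Integrable fun ξ => ‖𝓕 h ξ‖ ^ 2 * Real.exp (-Real.pi * ‖ξ‖ ^ 2) := by
  refine integrable_gaussian.bdd_mul (c := (∫ x, ‖h x‖) ^ 2)
    ((continuous_fourier hh).norm.pow 2).aestronglyMeasurable (.of_forall fun ξ => ?_)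
  rw [norm_pow, norm_norm]
  gcongr
  exact VectorFourier.norm_fourierIntegral_le_integral_norm _ _ _ _ _

/-- For real `h`, conjugating the transform reflects `h`. The multiplication formula then moves the
transform onto a modulated Gaussian, leaving the convolution of `h` with a Gaussian. -/
lemma fourier_conj_fourier_mul_gaussian {h : V → ℝ} (hh : Integrable h) (x : V) :
    𝓕 (fun ξ => conj (𝓕 (fun x => (h x : ℂ)) ξ) * (Real.exp (-Real.pi * ‖ξ‖ ^ 2) : ℂ)) x =
      ((∫ y, h y * Real.exp (-Real.pi * ‖x - y‖ ^ 2) : ℝ) : ℂ) := by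
  have hneg : Integrable fun x => (h (-x) : ℂ) := hh.comp_neg.ofReal
  have hg : Integrable fun ξ : V => Complex.exp (↑(2 * Real.pi * ⟪-x, ξ⟫) * Complex.I) *
      (Real.exp (-Real.pi * ‖ξ‖ ^ 2) : ℂ) := by
    refine integrable_gaussian.ofReal.bdd_mul (c := 1) ?_ (.of_forall fun ξ => ?_)
    · exact (by fun_prop : Continuous _).aestronglyMeasurable
    · rw [Complex.norm_exp_ofReal_mul_I]
  have key := integral_fourier_mul hneg hg
  rw [Real.fourier_eq']
  have e1 : ∀ ξ : V, Complex.exp (↑(-2 * Real.pi * ⟪ξ, x⟫) * Complex.I) •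
      (conj (𝓕 (fun x => (h x : ℂ)) ξ) * (Real.exp (-Real.pi * ‖ξ‖ ^ 2) : ℂ)) =
      𝓕 (fun x => (h (-x) : ℂ)) ξ * (Complex.exp (↑(2 * Real.pi * ⟪-x, ξ⟫) * Complex.I) *
      (Real.exp (-Real.pi * ‖ξ‖ ^ 2) : ℂ)) := by
    intro ξ
    rw [conj_fourier_ofReal, inner_neg_left, real_inner_comm, smul_eq_mul]
    simp only [neg_mul, mul_neg]
    ring
  simp_rw [e1]
  rw [key, ← integral_neg_eq_self]
  simp_rw [fourier_gaussian_modulated, neg_neg]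
  rw [← integral_complex_ofReal]
  congr 1
  ext y
  rw [← norm_neg (x - y), Complex.ofReal_mul]
  congr 5
  abel_nf

/-- Bessel-type inequality for the Fourier transform with a Gaussian weight. -/
theorem integral_norm_sq_fourier_mul_gaussian_le {h : V → ℝ} (hh : Integrable h)
    (h2 : Integrable fun x => h x ^ 2) :
    ∫ ξ, ‖𝓕 (fun x => (h x : ℂ)) ξ‖ ^ 2 * Real.exp (-Real.pi * ‖ξ‖ ^ 2) ≤ ∫ x, h x ^ 2 := by
  set H := 𝓕 (fun x => (h x : ℂ)) 
  set k : V → ℝ := fun x => ∫ y, h y * Real.exp (-Real.pi * ‖x - y‖ ^ 2) with hk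
  have hg : Integrable fun ξ => conj (H ξ) * (Real.exp (-Real.pi * ‖ξ‖ ^ 2) : ℂ) := by
    have : ∀ ξ, conj (H ξ) = 𝓕 (fun x => (h (-x) : ℂ)) ξ := conj_fourier_ofReal h
    simp_rw [this]
    exact integrable_fourier_mul_gaussian hh.comp_neg.ofReal
  have key := integral_fourier_mul hh.ofReal hg
  simp_rw [H, fourier_conj_fourier_mul_gaussian hh] at key
  have hl : ∫ ξ, ‖H ξ‖ ^ 2 * Real.exp (-Real.pi * ‖ξ‖ ^ 2) = ∫ x, h x * k x := by
    apply Complex.ofReal_injective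
    rw [← integral_complex_ofReal, ← integral_complex_ofReal]
    convert key using 1
    · congr 1
      ext ξ
      rw [← mul_assoc]
      change _ = H ξ * conj (H ξ) * _
      rw [Complex.mul_conj, Complex.normSq_eq_norm_sq]
      push_cast; rfl
    · simp [hk]
  rw [hl]
  set G : V → ℝ := fun ξ => Real.exp (-Real.pi * ‖ξ‖ ^ 2) with hG
  have hconv := h2.integrable_convolution (ContinuousLinearMap.mul ℝ ℝ)
    (integrable_gaussian (V := V))
  have hconv_int := integral_convolution (ContinuousLinearMap.mul ℝ ℝ) h2
    (integrable_gaussian (V := V))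
  rw [integral_gaussian_eq_one] at hconv_int
  have hGi : ∀ x : V, Integrable fun y => G (x - y) := fun x => integrable_gaussian.comp_sub_left x
  have hGb : ∀ x, ‖G x‖ ≤ 1 := fun x => by
    rw [Real.norm_eq_abs, abs_of_pos (Real.exp_pos _), Real.exp_le_one_iff]
    nlinarith [Real.pi_pos, sq_nonneg ‖x‖]
  have hG1 : ∀ x : V, ∫ y, G (x - y) = 1 := fun x => by
    rw [integral_sub_left_eq_self (fun y => G y)]; exact integral_gaussian_eq_one
  have hmeas : ∀ x : V, AEStronglyMeasurable (fun y => G (x - y)) := fun x => (hGi x).1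
  -- The weighted Fourier energy is now `∫∫ h x h y G (x - y)`. Since `G` has mass one, `h x h y ≤
  -- (h x ^ 2 + h y ^ 2) / 2` bounds it by `∫ h ^ 2`.
  have hpt : ∀ x, h x * k x ≤ (h x ^ 2 + ∫ y, h y ^ 2 * G (x - y)) / 2 := by
    intro x
    have i1 : Integrable fun y => h y * G (x - y) :=
      hh.mul_bdd (hmeas x) (.of_forall fun y => hGb _)
    have i2 : Integrable fun y => h y ^ 2 * G (x - y) :=
      h2.mul_bdd (hmeas x) (.of_forall fun y => hGb _)
    have : h x * k x = ∫ y, h x * (h y * G (x - y)) := by rw [integral_const_mul]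
    rw [this]
    have e2 : (h x ^ 2 + ∫ y, h y ^ 2 * G (x - y)) / 2 =
        ∫ y, (h x ^ 2 * G (x - y) + h y ^ 2 * G (x - y)) / 2 := by
      rw [integral_div, integral_add ((hGi x).const_mul _) i2, integral_const_mul, hG1, mul_one]
    rw [e2]
    refine integral_mono (i1.const_mul _) ((((hGi x).const_mul _).add i2).div_const 2) fun y => ?_
    have : 0 < G (x - y) := Real.exp_pos _
    simp only
    nlinarith [mul_nonneg this.le (sq_nonneg (h x - h y))]
  have hc : ∀ x, ∫ y, h y ^ 2 * G (x - y) =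
    convolution (fun y => h y ^ 2) G (ContinuousLinearMap.mul ℝ ℝ) volume x := fun x => rfl
  simp_rw [hc] at hpt
  have hint : ∫ x, (h x ^ 2 + convolution (fun y => h y ^ 2) G (ContinuousLinearMap.mul ℝ ℝ)
      volume x) / 2 = ∫ x, h x ^ 2 := by
    rw [integral_div, integral_add h2 hconv, hconv_int]
    simp
  rw [← hint]
  by_cases hi : Integrable fun x => h x * k x
  · exact integral_mono hi ((h2.add hconv).div_const 2) hpt
  · rw [integral_undef hi, hint]
    exact integral_nonneg fun x => sq_nonneg _

end Fourier

/-! ### Separation of mixtures in `L²` -/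

/-- Since `e^{ia} - 1 = 2i sin (a/2) e^{ia/2}`, multiplying by `e^{-ia/2}` and taking the real part
eliminates the unknown weight `l`. -/
lemma abs_sin_half_mul_abs_sin_le_norm (l m a b : ℝ) :
    2 * (|m| * (|Real.sin (b / 2)| * |Real.sin ((b - a) / 2)|)) ≤
      ‖(l : ℂ) * (Complex.exp (a * Complex.I) - 1) - m * (Complex.exp (b * Complex.I) - 1)‖ := by
  set z := (l : ℂ) * (Complex.exp (a * Complex.I) - 1) - m * (Complex.exp (b * Complex.I) - 1)
  have hz : (z * Complex.exp (((-(a / 2) : ℝ) : ℂ) * Complex.I)).re =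
      2 * (m * (Real.sin (b / 2) * Real.sin ((b - a) / 2))) := by
    have ha : a = 2 * (a / 2) := by ring
    have hb : b = 2 * (b / 2) := by ring
    have hba : (b - a) / 2 = b / 2 - a / 2 := by ring
    rw [hba, Real.sin_sub]
    simp only [z, Complex.mul_re, Complex.sub_re, Complex.sub_im, Complex.mul_im,
      Complex.exp_ofReal_mul_I_re, Complex.exp_ofReal_mul_I_im, Complex.ofReal_re,
      Complex.ofReal_im, Complex.one_re, Complex.one_im, Real.cos_neg, Real.sin_neg]
    have ca : Real.cos a = 1 - 2 * Real.sin (a / 2) ^ 2 := by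
      rw [← Real.cos_two_mul_eq_one_sub, ← ha]
    have sa : Real.sin a = 2 * Real.sin (a / 2) * Real.cos (a / 2) := by
      rw [← Real.sin_two_mul, ← ha]
    have cb : Real.cos b = 1 - 2 * Real.sin (b / 2) ^ 2 := by
      rw [← Real.cos_two_mul_eq_one_sub, ← hb]
    have sb : Real.sin b = 2 * Real.sin (b / 2) * Real.cos (b / 2) := by
      rw [← Real.sin_two_mul, ← hb]
    rw [ca, sa, cb, sb]
    ring
  have := (Complex.abs_re_le_norm (z * Complex.exp (((-(a / 2) : ℝ) : ℂ) * Complex.I)))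
  rw [hz, norm_mul, Complex.norm_exp_ofReal_mul_I, mul_one] at this
  simpa [abs_mul] using this

/-- The midpoint of `u` and `v` works: its inner product with either one is `(1 + ⟪u, v⟫) / 2`. -/
lemma exists_norm_le_and_le_inner_of_norm_eq_one {V : Type*} [NormedAddCommGroup V]
    [InnerProductSpace ℝ V] {u v : V} (hu : ‖u‖ = 1) (hv : ‖v‖ = 1) (huv : 0 ≤ ⟪u, v⟫) :
    ∃ x : V, ‖x‖ ≤ 1 ∧ 1 / 2 ≤ ⟪u, x⟫ ∧ 1 / 2 ≤ ⟪v, x⟫ := by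
  refine ⟨(1 / 2 : ℝ) • (u + v), ?_, ?_, ?_⟩
  · rw [norm_smul]
    have := norm_add_le u v
    norm_num
    linarith
  · rw [inner_smul_right, inner_add_right, real_inner_self_eq_norm_sq, hu]
    linarith
  · rw [inner_smul_right, inner_add_right, real_inner_self_eq_norm_sq, hv, real_inner_comm]
    linarith

/-- Two nonzero vectors have simultaneously large inner products with all points of a suitable
ball. -/
lemma exists_ball_mul_norm_le_abs_inner {V : Type*} [NormedAddCommGroup V] [InnerProductSpace ℝ V]
    {r : ℝ} (hr : 0 < r) {u v : V} (hu : u ≠ 0) (hv : v ≠ 0) :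
    ∃ x₀ : V, ∀ x ∈ Metric.ball x₀ (r / 8), ‖x‖ ≤ r ∧
      r / 8 * ‖u‖ ≤ |⟪u, x⟫| ∧ r / 8 * ‖v‖ ≤ |⟪v, x⟫| := by
  have unit : ∀ w : V, w ≠ 0 → ‖(‖w‖⁻¹ : ℝ) • w‖ = 1 := fun w hw => by
    rw [norm_smul, norm_inv, norm_norm, inv_mul_cancel₀ (norm_ne_zero_iff.2 hw)]
  obtain ⟨x₀, hx, hux, hvx⟩ : ∃ x : V, ‖x‖ ≤ 1 ∧ ‖u‖ / 2 ≤ |⟪u, x⟫| ∧ ‖v‖ / 2 ≤ |⟪v, x⟫| := by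
    have scale : ∀ w x : V, w ≠ 0 → 1 / 2 ≤ |⟪(‖w‖⁻¹ : ℝ) • w, x⟫| → ‖w‖ / 2 ≤ |⟪w, x⟫| := by
      intro w x hw h
      have hw' := norm_pos_iff.2 hw
      rw [real_inner_smul_left, abs_mul, abs_inv, abs_norm, inv_mul_eq_div,
        le_div_iff₀ hw'] at h
      linarith
    rcases le_total 0 ⟪(‖u‖⁻¹ : ℝ) • u, (‖v‖⁻¹ : ℝ) • v⟫ with h | h
    · obtain ⟨x, h1, h2, h3⟩ := exists_norm_le_and_le_inner_of_norm_eq_one (unit u hu) (unit v hv) h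
      exact ⟨x, h1, scale u x hu (h2.trans (le_abs_self _)), scale v x hv (h3.trans (le_abs_self _))⟩
    -- At an obtuse angle, replace `v` by `-v`; absolute values do not see the sign.
    · obtain ⟨x, h1, h2, h3⟩ := exists_norm_le_and_le_inner_of_norm_eq_one (unit u hu)
        (v := -((‖v‖⁻¹ : ℝ) • v)) (by rw [norm_neg, unit v hv]) (by rw [inner_neg_right]; linarith)
      rw [inner_neg_left] at h3
      exact ⟨x, h1, scale u x hu (h2.trans (le_abs_self _)), scale v x hv (h3.trans (neg_le_abs _))⟩
  -- The centre `(r / 2) • x₀` gives at least `r / 4 * ‖w‖`, and moving by less than `r / 8` loses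
  -- at most half of it.
  have near : ∀ w x : V, ‖w‖ / 2 ≤ |⟪w, x₀⟫| → dist x ((r / 2) • x₀) < r / 8 →
      r / 8 * ‖w‖ ≤ |⟪w, x⟫| := by
    intro w x hw hxd
    have h1 : |⟪w, (r / 2) • x₀ - x⟫| ≤ ‖w‖ * (r / 8) := by
      refine (abs_real_inner_le_norm _ _).trans ?_
      rw [dist_comm, dist_eq_norm] at hxd
      gcongr
    have h2 : |⟪w, (r / 2) • x₀⟫| = r / 2 * |⟪w, x₀⟫| := by
      rw [inner_smul_right, abs_mul, abs_of_pos (by positivity)]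
    have h3 : |⟪w, (r / 2) • x₀⟫| ≤ |⟪w, x⟫| + |⟪w, (r / 2) • x₀ - x⟫| := by
      have : ⟪w, (r / 2) • x₀⟫ = ⟪w, x⟫ + ⟪w, (r / 2) • x₀ - x⟫ := by
        rw [← inner_add_right, add_sub_cancel]
      rw [this]; exact abs_add_le _ _
    nlinarith [mul_le_mul_of_nonneg_left hw hr.le]
  refine ⟨(r / 2) • x₀, fun x hxb => ?_⟩
  rw [Metric.mem_ball] at hxb
  refine ⟨?_, near u x hux hxb, near v x hvx hxb⟩
  have h1 : ‖x‖ ≤ ‖(r / 2) • x₀‖ + dist x ((r / 2) • x₀) := by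
    have := norm_add_le ((r / 2) • x₀) (x - (r / 2) • x₀)
    rwa [add_sub_cancel, ← dist_eq_norm] at this
  rw [norm_smul, Real.norm_of_nonneg (by positivity)] at h1
  nlinarith

/-- Writing a mixture as `φ + λ (φ(· - μ) - φ)`, the common `φ` cancels and each translation becomes
a phase factor on `φ̂`. -/
lemma fourier_mixture_sub {d : ℕ} {φ : Eucl d → ℝ} (hφ : Integrable φ) (θ θ' : ℝ × Eucl d)
    (ξ : Eucl d) :
    𝓕 (fun x => ((mixture φ θ x - mixture φ θ' x : ℝ) : ℂ)) ξ =
      ((θ.1 : ℂ) * (Complex.exp (↑(-(2 * Real.pi * ⟪θ.2, ξ⟫)) * Complex.I) - 1) -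
        θ'.1 * (Complex.exp (↑(-(2 * Real.pi * ⟪θ'.2, ξ⟫)) * Complex.I) - 1)) *
      𝓕 (fun x => (φ x : ℂ)) ξ := by
  have hi : ∀ f : Eucl d → ℝ, Integrable f → Integrable fun v =>
      Complex.exp (↑(-2 * Real.pi * ⟪v, ξ⟫) * Complex.I) • (f v : ℂ) := fun f hf => by
    simpa [Circle.smul_def, Real.fourierChar_apply] using
      (Real.fourierIntegral_convergent_iff (μ := volume) (f := fun x => (f x : ℂ)) ξ).2 hf.ofReal
  have h0 := hi _ hφ
  have h1 := hi _ (hφ.comp_sub_right θ.2)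
  have h2 := hi _ (hφ.comp_sub_right θ'.2)
  have t1 := fourier_comp_sub (fun x => (φ x : ℂ)) θ.2 ξ
  have t2 := fourier_comp_sub (fun x => (φ x : ℂ)) θ'.2 ξ
  have : 𝓕 (fun x => ((mixture φ θ x - mixture φ θ' x : ℝ) : ℂ)) ξ =
      (θ.1 : ℂ) * (𝓕 (fun x => (φ (x - θ.2) : ℂ)) ξ - 𝓕 (fun x => (φ x : ℂ)) ξ) -
        θ'.1 * (𝓕 (fun x => (φ (x - θ'.2) : ℂ)) ξ - 𝓕 (fun x => (φ x : ℂ)) ξ) := by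
    simp only [Real.fourier_eq']
    rw [← integral_sub h1 h0, ← integral_sub h2 h0, ← integral_const_mul, ← integral_const_mul]
    refine Eq.trans ?_ (integral_sub ((h1.sub h0).const_mul (θ.1 : ℂ))
      ((h2.sub h0).const_mul (θ'.1 : ℂ)))
    congr 1
    ext v
    simp only [mixture, smul_eq_mul]
    push_cast
    ring
  rw [this, t1, t2]
  ring

lemma exists_forall_half_le_norm_fourier {d : ℕ} {φ : Eucl d → ℝ} (hφ : Integrable φ)
    (h1 : ∫ x, φ x = 1) :
    ∃ r > 0, ∀ ξ, ‖ξ‖ ≤ r → 1 / 2 ≤ ‖𝓕 (fun x => (φ x : ℂ)) ξ‖ := by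
  have h0 : 𝓕 (fun x => (φ x : ℂ)) 0 = 1 := by
    rw [Real.fourier_eq']
    simp [integral_complex_ofReal, h1]
  have hc := (continuous_fourier (h := fun x => (φ x : ℂ)) hφ.ofReal).norm.tendsto 0
  rw [h0, norm_one] at hc
  obtain ⟨r, hr, h⟩ := Metric.eventually_nhds_iff.1 (hc.eventually (lt_mem_nhds one_half_lt_one))
  refine ⟨r / 2, by positivity, fun ξ hξ => (h ?_).le⟩
  rw [dist_zero_right]
  linarith

lemma mul_abs_le_abs_sin_pi_mul {x : ℝ} (hx : |x| ≤ 1 / 2) : 2 * |x| ≤ |Real.sin (Real.pi * x)| := by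
  have hp := Real.pi_pos
  have := Real.mul_abs_le_abs_sin (x := Real.pi * x) (by rw [abs_mul, abs_of_pos hp]; nlinarith)
  rw [abs_mul, abs_of_pos hp] at this
  convert this using 1
  field_simp

lemma memLp_mixture {d : ℕ} {φ : Eucl d → ℝ} {p : ENNReal} (h : MemLp φ p) (θ : ℝ × Eucl d) :
    MemLp (mixture φ θ) p :=
  (h.const_mul _).add
    ((h.comp_measurePreserving (measurePreserving_sub_right volume θ.2)).const_mul _)

/-- The `L²` distance between two mixtures controls the distance between the locations. -/
theorem exists_mul_le_integral_mixture_sub_sq {d : ℕ} {φ : Eucl d → ℝ} (hφ : Integrable φ)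
    (h1 : ∫ x, φ x = 1) (h2 : MemLp φ 2) {R : ℝ} (hR : 0 < R) :
    ∃ c > 0, ∀ θ θ' : ℝ × Eucl d, ‖θ.2‖ ≤ R → ‖θ'.2‖ ≤ R →
      c * ((θ'.1 * ‖θ'.2‖) ^ 2 * ‖θ.2 - θ'.2‖ ^ 2) ≤
        ∫ x, (mixture φ θ x - mixture φ θ' x) ^ 2 := by
  obtain ⟨r₀, hr₀, hhalf⟩ := exists_forall_half_le_norm_fourier hφ h1
  -- The bound `1 / (4 * R)` keeps `|⟪μ, ξ⟫| ≤ 1/4` for both locations, hence `1/2` for their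
  -- difference: the range in which `|sin (π x)| ≥ 2 |x|`.
  set r := min r₀ (1 / (4 * R)) with hrdef
  have hr : 0 < r := lt_min hr₀ (by positivity)
  have hRr : R * r ≤ 1 / 4 := by
    have : r ≤ 1 / (4 * R) := min_le_right _ _
    calc R * r ≤ R * (1 / (4 * R)) := by gcongr
      _ = 1 / 4 := by field_simp
  have hvol : 0 < volume.real (Metric.ball (0 : Eucl d) (r / 8)) :=
    ENNReal.toReal_pos (Metric.measure_ball_pos _ _ (by positivity)).ne' measure_ball_lt_top.ne
  refine ⟨volume.real (Metric.ball (0 : Eucl d) (r / 8)) *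
    ((r / 4) ^ 4 * Real.exp (-Real.pi * r ^ 2)), by positivity, fun θ θ' hθ hθ' => ?_⟩
  rcases eq_or_ne θ'.2 0 with hu | hu
  · simpa [hu] using integral_nonneg fun x => sq_nonneg _
  rcases eq_or_ne (θ.2 - θ'.2) 0 with hv | hv
  · simpa [hv] using integral_nonneg fun x => sq_nonneg _
  have hint : Integrable fun x => mixture φ θ x - mixture φ θ' x := by
    have := fun θ => (memLp_one_iff_integrable.1 (memLp_mixture (memLp_one_iff_integrable.2 hφ) θ))
    exact (this θ).sub (this θ')
  refine le_trans ?_ (integral_norm_sq_fourier_mul_gaussian_le hint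
    ((memLp_mixture h2 θ).sub (memLp_mixture h2 θ')).integrable_sq)
  obtain ⟨x₀, hx₀⟩ := exists_ball_mul_norm_le_abs_inner hr hu hv
  have hI := integrable_norm_sq_fourier_mul_gaussian hint.ofReal
  refine le_trans ?_ (setIntegral_le_integral (s := Metric.ball x₀ (r / 8)) hI
    (.of_forall fun ξ => by positivity))
  have hpt : ∀ ξ ∈ Metric.ball x₀ (r / 8),
      ((r / 4) ^ 4 * Real.exp (-Real.pi * r ^ 2)) *
        ((θ'.1 * ‖θ'.2‖) ^ 2 * ‖θ.2 - θ'.2‖ ^ 2) ≤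
      ‖𝓕 (fun x => ((mixture φ θ x - mixture φ θ' x : ℝ) : ℂ)) ξ‖ ^ 2 *
        Real.exp (-Real.pi * ‖ξ‖ ^ 2) := by
    intro ξ hξ
    obtain ⟨hn, hiu, hiv⟩ := hx₀ ξ hξ
    rw [fourier_mixture_sub hφ, norm_mul]
    have hf := hhalf ξ (hn.trans (min_le_left _ _))
    have hz := abs_sin_half_mul_abs_sin_le_norm θ.1 θ'.1 (-(2 * Real.pi * ⟪θ.2, ξ⟫))
      (-(2 * Real.pi * ⟪θ'.2, ξ⟫))
    set z := ‖(θ.1 : ℂ) * (Complex.exp (↑(-(2 * Real.pi * ⟪θ.2, ξ⟫)) * Complex.I) - 1) -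
        θ'.1 * (Complex.exp (↑(-(2 * Real.pi * ⟪θ'.2, ξ⟫)) * Complex.I) - 1)‖
    have inner_le : ∀ w : Eucl d, ‖w‖ ≤ R → |⟪w, ξ⟫| ≤ 1 / 4 := fun w hw =>
      (abs_real_inner_le_norm _ _).trans ((by gcongr : ‖w‖ * ‖ξ‖ ≤ R * r).trans hRr)
    have hdiff : |⟪θ.2 - θ'.2, ξ⟫| ≤ 1 / 2 := by
      rw [inner_sub_left]
      have := inner_le _ hθ
      have := inner_le _ hθ'
      have := abs_sub ⟪θ.2, ξ⟫ ⟪θ'.2, ξ⟫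
      linarith
    have e1 : -(2 * Real.pi * ⟪θ'.2, ξ⟫) / 2 = -(Real.pi * ⟪θ'.2, ξ⟫) := by ring
    have e2 : (-(2 * Real.pi * ⟪θ'.2, ξ⟫) - -(2 * Real.pi * ⟪θ.2, ξ⟫)) / 2 =
        Real.pi * ⟪θ.2 - θ'.2, ξ⟫ := by rw [inner_sub_left]; ring
    rw [e1, e2, Real.sin_neg, abs_neg] at hz
    have s1 := mul_abs_le_abs_sin_pi_mul ((inner_le _ hθ').trans (by norm_num))
    have s2 := mul_abs_le_abs_sin_pi_mul hdiff
    have hlow : (r / 4) ^ 2 * (|θ'.1| * ‖θ'.2‖ * ‖θ.2 - θ'.2‖) ≤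
        z * ‖𝓕 (fun x => (φ x : ℂ)) ξ‖ :=
      calc (r / 4) ^ 2 * (|θ'.1| * ‖θ'.2‖ * ‖θ.2 - θ'.2‖)
          = 2 * (|θ'.1| * ((2 * (r / 8 * ‖θ'.2‖)) * (2 * (r / 8 * ‖θ.2 - θ'.2‖)))) * (1 / 2) := by
            ring
        _ ≤ 2 * (|θ'.1| * (|Real.sin (Real.pi * ⟪θ'.2, ξ⟫)| *
            |Real.sin (Real.pi * ⟪θ.2 - θ'.2, ξ⟫)|)) * ‖𝓕 (fun x => (φ x : ℂ)) ξ‖ := by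
            gcongr
            · exact le_trans (by gcongr) s1
            · exact le_trans (by gcongr) s2
        _ ≤ _ := by gcongr
    calc (r / 4) ^ 4 * Real.exp (-Real.pi * r ^ 2) * ((θ'.1 * ‖θ'.2‖) ^ 2 * ‖θ.2 - θ'.2‖ ^ 2)
        = ((r / 4) ^ 2 * (|θ'.1| * ‖θ'.2‖ * ‖θ.2 - θ'.2‖)) ^ 2 * Real.exp (-Real.pi * r ^ 2) := by
          rw [mul_pow θ'.1, ← sq_abs θ'.1]; ring
      _ ≤ (z * ‖𝓕 (fun x => (φ x : ℂ)) ξ‖) ^ 2 * Real.exp (-Real.pi * ‖ξ‖ ^ 2) := by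
          gcongr ?_ ^ 2 * Real.exp ?_
          have := Real.pi_pos
          nlinarith [pow_le_pow_left₀ (norm_nonneg ξ) hn 2]
  have hball : volume.real (Metric.ball (0 : Eucl d) (r / 8)) =
      volume.real (Metric.ball x₀ (r / 8)) := by
    rw [measureReal_def, measureReal_def, Measure.addHaar_ball_center volume x₀]
  rw [mul_assoc, hball, ← smul_eq_mul, ← setIntegral_const]
  exact setIntegral_mono_on (integrableOn_const measure_ball_lt_top.ne) hI.integrableOn
    measurableSet_ball hpt

/-! ### Consequences of the Lipschitz assumption -/

lemma abs_apply_le_norm {d : ℕ} (v : Eucl d) (j : Fin d) : |v j| ≤ ‖v‖ := by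
  simpa using PiLp.norm_apply_le v j

lemma norm_sq_le_of_abs_apply_le {d : ℕ} {v : Eucl d} {t : ℝ} (h : ∀ j, |v j| ≤ t) :
    ‖v‖ ^ 2 ≤ d * t ^ 2 := by
  rw [EuclideanSpace.norm_sq_eq]
  calc ∑ j, ‖v j‖ ^ 2 ≤ ∑ _j : Fin d, t ^ 2 :=
        Finset.sum_le_sum fun j _ => pow_le_pow_left₀ (norm_nonneg _) (h j) 2
    _ = d * t ^ 2 := by simp

/-- Averaging `φ y ^ 2 ≤ 2 φ x ^ 2 + 2 M² g x ^ 2` over the ball of radius `M` about `y` bounds `φ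
y` by `L²` norms, uniformly in `y`. -/
lemma exists_forall_le_of_lipschitz {d : ℕ} {M : ℝ} (hM : 0 < M) {φ g : Eucl d → ℝ}
    (h0 : ∀ x, 0 ≤ φ x) (hφ : MemLp φ 2) (hg : MemLp g 2)
    (hlip : ∀ x : Eucl d, ∀ μ ∈ cube d M, |φ x - φ (x - μ)| ≤ ‖μ‖ * g x) :
    ∃ B > 0, ∀ x, φ x ≤ B := by
  set v := volume.real (Metric.ball (0 : Eucl d) M) with hv
  have hvol : 0 < v :=
    ENNReal.toReal_pos (Metric.measure_ball_pos _ _ hM).ne' measure_ball_lt_top.ne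
  set A := ∫ x, 2 * φ x ^ 2 + 2 * M ^ 2 * g x ^ 2 with hA
  have hint : Integrable fun x => 2 * φ x ^ 2 + 2 * M ^ 2 * g x ^ 2 :=
    (hφ.integrable_sq.const_mul _).add (hg.integrable_sq.const_mul _)
  have hsq : ∀ y, φ y ^ 2 ≤ A / v := by
    intro y
    rw [le_div_iff₀ hvol, mul_comm]
    have hpt : ∀ x ∈ Metric.ball y M, φ y ^ 2 ≤ 2 * φ x ^ 2 + 2 * M ^ 2 * g x ^ 2 := by
      intro x hx
      rw [Metric.mem_ball, dist_eq_norm] at hx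
      have h := hlip x (x - y) fun j => (abs_apply_le_norm _ j).trans hx.le
      rw [sub_sub_cancel] at h
      have h1 : φ y ≤ φ x + ‖x - y‖ * g x := by linarith [(abs_le.1 h).1]
      have h2 : (‖x - y‖ * g x) ^ 2 ≤ M ^ 2 * g x ^ 2 := by
        rw [mul_pow]; gcongr
      nlinarith [sq_nonneg (φ x - ‖x - y‖ * g x), pow_le_pow_left₀ (h0 y) h1 2]
    have hball : v = volume.real (Metric.ball y M) := by
      rw [hv, measureReal_def, measureReal_def, Measure.addHaar_ball_center volume y]
    rw [hball, ← smul_eq_mul, ← setIntegral_const]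
    exact (setIntegral_mono_on (integrableOn_const measure_ball_lt_top.ne) hint.integrableOn
      measurableSet_ball hpt).trans (setIntegral_le_integral hint
        (.of_forall fun x => by positivity))
  refine ⟨√(A / v) + 1, by positivity, fun x => ?_⟩
  linarith [Real.le_sqrt_of_sq_le (hsq x)]

lemma integral_translate_sub_sq_le {d : ℕ} {M : ℝ} {φ g : Eucl d → ℝ}
    (hφ : MemLp φ 2) (hg : MemLp g 2)
    (hlip : ∀ x : Eucl d, ∀ μ ∈ cube d M, |φ x - φ (x - μ)| ≤ ‖μ‖ * g x)
    {μ ν : Eucl d} (h : μ - ν ∈ cube d M) :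
    ∫ x, (φ (x - μ) - φ (x - ν)) ^ 2 ≤ ‖μ - ν‖ ^ 2 * ∫ x, g x ^ 2 := by
  have e : ∫ x, (φ (x - μ) - φ (x - ν)) ^ 2 = ∫ x, (φ (x - (μ - ν)) - φ x) ^ 2 := by
    rw [← integral_sub_right_eq_self (fun x => (φ (x - (μ - ν)) - φ x) ^ 2) ν]
    simp
  rw [e, ← integral_const_mul]
  refine integral_mono ?_ (hg.integrable_sq.const_mul _) fun x => ?_
  · exact ((hφ.comp_measurePreserving (measurePreserving_sub_right volume (μ - ν))).sub
      hφ).integrable_sq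
  · have := pow_le_pow_left₀ (abs_nonneg _) (hlip x _ h) 2
    rw [sq_abs, mul_pow] at this
    simp only
    nlinarith

lemma integral_mixture_sub_sq_le {d : ℕ} {M : ℝ} {φ g : Eucl d → ℝ}
    (hφ : MemLp φ 2) (hg : MemLp g 2)
    (hlip : ∀ x : Eucl d, ∀ μ ∈ cube d M, |φ x - φ (x - μ)| ≤ ‖μ‖ * g x)
    {θ θ' : ℝ × Eucl d} (hθ' : |θ'.1| ≤ 1) (h : θ.2 - θ'.2 ∈ cube d M) :
    ∫ x, (mixture φ θ x - mixture φ θ' x) ^ 2 ≤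
      8 * (θ.1 - θ'.1) ^ 2 * (∫ x, φ x ^ 2) + 2 * (‖θ.2 - θ'.2‖ ^ 2 * ∫ x, g x ^ 2) := by
  have hsh : ∀ μ : Eucl d, MemLp (fun x => φ (x - μ)) 2 := fun μ =>
    hφ.comp_measurePreserving (measurePreserving_sub_right volume μ)
  have hi1 := (hsh θ.2).integrable_sq
  have hi2 := hφ.integrable_sq
  have hi3 : Integrable fun x => (φ (x - θ.2) - φ (x - θ'.2)) ^ 2 :=
    ((hsh θ.2).sub (hsh θ'.2)).integrable_sq
  have hi12 : Integrable fun x => φ (x - θ.2) ^ 2 + φ x ^ 2 := hi1.add hi2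
  have hshift : ∫ x, φ (x - θ.2) ^ 2 = ∫ x, φ x ^ 2 :=
    integral_sub_right_eq_self (fun x => φ x ^ 2) θ.2
  calc ∫ x, (mixture φ θ x - mixture φ θ' x) ^ 2
      ≤ ∫ x, (4 * (θ.1 - θ'.1) ^ 2 * (φ (x - θ.2) ^ 2 + φ x ^ 2) +
          2 * (φ (x - θ.2) - φ (x - θ'.2)) ^ 2) := by
        refine integral_mono ((memLp_mixture hφ θ).sub (memLp_mixture hφ θ')).integrable_sq
          ((hi12.const_mul _).add (hi3.const_mul _)) fun x => ?_
        -- Change the weight first, at fixed location, and then the location, at fixed weight.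
        have e : mixture φ θ x - mixture φ θ' x = (θ.1 - θ'.1) * (φ (x - θ.2) - φ x) +
          θ'.1 * (φ (x - θ.2) - φ (x - θ'.2)) := by simp only [mixture]; ring
        have h1 : θ'.1 ^ 2 ≤ 1 := (sq_le_one_iff_abs_le_one _).2 hθ'
        simp only [e]
        set p := φ (x - θ.2) - φ (x - θ'.2)
        set q := φ (x - θ.2) - φ x with hq
        have h2 : q ^ 2 ≤ 2 * (φ (x - θ.2) ^ 2 + φ x ^ 2) := by
          rw [hq]; nlinarith [sq_nonneg (φ (x - θ.2) + φ x)]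
        calc ((θ.1 - θ'.1) * q + θ'.1 * p) ^ 2
            ≤ 2 * ((θ.1 - θ'.1) ^ 2 * q ^ 2) + 2 * (θ'.1 ^ 2 * p ^ 2) := by
              nlinarith [sq_nonneg ((θ.1 - θ'.1) * q - θ'.1 * p)]
          _ ≤ 2 * ((θ.1 - θ'.1) ^ 2 * (2 * (φ (x - θ.2) ^ 2 + φ x ^ 2))) + 2 * (1 * p ^ 2) := by
              gcongr
          _ = _ := by ring
    _ = 8 * (θ.1 - θ'.1) ^ 2 * (∫ x, φ x ^ 2) +
          2 * ∫ x, (φ (x - θ.2) - φ (x - θ'.2)) ^ 2 := by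
        rw [integral_add (hi12.const_mul _) (hi3.const_mul _), integral_const_mul,
          integral_const_mul, integral_add hi1 hi2, hshift]
        ring
    _ ≤ _ := by gcongr; exact integral_translate_sub_sq_le hφ hg hlip h

/-! ### The grid -/

/-- The grid omits zero, so `y < 1` is rounded up to `1`; `1 ≤ L` keeps this admissible. -/
lemma exists_nat_abs_sub_le_one {y L : ℝ} (hy : 0 ≤ y) (hyL : y ≤ L) (hL : 1 ≤ L) :
    ∃ k : ℕ, 1 ≤ k ∧ (k : ℝ) ≤ L ∧ |(k : ℝ) - y| ≤ 1 := by
  refine ⟨max 1 ⌊y⌋₊, le_max_left _ _, ?_, ?_⟩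
  · rw [Nat.cast_max, Nat.cast_one]
    exact max_le hL ((Nat.floor_le hy).trans hyL)
  · have h1 := Nat.floor_le hy
    have h2 := Nat.lt_floor_add_one y
    rcases le_total 1 ⌊y⌋₊ with h | h
    · rw [max_eq_right h, abs_le]; constructor <;> linarith
    · rw [max_eq_left h, abs_le]
      have : (⌊y⌋₊ : ℝ) ≤ 1 := by exact_mod_cast h
      push_cast
      constructor <;> linarith

lemma exists_mem_grid_abs_sub_le {d : ℕ} {M : ℝ} {n : ℕ} (hn : 1 ≤ n) (hMn : 1 ≤ M * √(n : ℝ))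
    {θ : ℝ × Eucl d} (h1 : θ.1 ∈ Set.Icc (0 : ℝ) 1) (h2 : θ.2 ∈ cube d M) :
    ∃ θ' ∈ grid d M n, |θ'.1 - θ.1| ≤ 1 / √(n : ℝ) ∧
      ∀ j, |(θ'.2 - θ.2) j| ≤ 1 / √(n : ℝ) := by
  have hs1 : 1 ≤ √(n : ℝ) := Real.one_le_sqrt.2 (by exact_mod_cast hn)
  set s := √(n : ℝ)
  have hs : 0 < s := by linarith
  have scale : ∀ k y : ℝ, |k - y * s| ≤ 1 → |k / s - y| ≤ 1 / s := by
    intro k y h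
    have : k / s - y = (k - y * s) / s := by field_simp
    rw [this, abs_div, abs_of_pos hs]
    gcongr
  obtain ⟨i, hi1, hi2, hi3⟩ := exists_nat_abs_sub_le_one (y := θ.1 * s) (L := s)
    (mul_nonneg h1.1 hs.le) (mul_le_of_le_one_left hs.le h1.2) hs1
  have hk : ∀ j, ∃ k : ℕ, 1 ≤ k ∧ (k : ℝ) ≤ M * s ∧ |(k : ℝ) - |θ.2 j| * s| ≤ 1 := fun j =>
    exists_nat_abs_sub_le_one (by positivity) (by have := h2 j; gcongr) hMn
  choose k hk1 hk2 hk3 using hk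
  refine ⟨(i / s, WithLp.toLp 2 fun j => if 0 ≤ θ.2 j then (k j : ℝ) / s else -(k j / s)),
    ⟨⟨i, hi1, hi2, rfl⟩, fun j => ⟨k j, hk1 j, hk2 j, ?_⟩⟩, scale _ _ hi3, fun j => ?_⟩
  · by_cases h : 0 ≤ θ.2 j <;> simp [h, s]
  · have h3 := scale _ _ (hk3 j)
    by_cases h : 0 ≤ θ.2 j
    · rw [abs_of_nonneg h] at h3
      simpa [h] using h3
    · rw [abs_of_neg (not_le.1 h)] at h3
      have : ((WithLp.toLp 2 fun j => if 0 ≤ θ.2 j then (k j : ℝ) / s else -(k j / s)) - θ.2) j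
        = -(k j / s - -(θ.2 j)) := by simp [h]; ring
      rw [this, abs_neg]
      exact h3

/-- Only the logarithm of the cardinality matters, so a crude count suffices: `i ≤ n` for the
weight, and for each coordinate a numerator and a sign. -/
lemma exists_finset_eq_grid (d : ℕ) (M : ℝ) (n : ℕ) :
    ∃ S : Finset (ℝ × Eucl d), (∀ θ, θ ∈ S ↔ θ ∈ grid d M n) ∧
      S.card ≤ (n + 1) * ((⌊M * √(n : ℝ)⌋₊ + 1) * 2) ^ d := by
  classical
  set L := ⌊M * √(n : ℝ)⌋₊
  let F : Fin (n + 1) × (Fin d → Fin (L + 1) × Bool) → ℝ × Eucl d := fun p =>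
    (((p.1 : ℕ) : ℝ) / √(n : ℝ), WithLp.toLp 2 fun j =>
      if (p.2 j).2 then (((p.2 j).1 : ℕ) : ℝ) / √(n : ℝ) else -((((p.2 j).1 : ℕ) : ℝ) / √(n : ℝ)))
  refine ⟨(Finset.univ.image F).filter (· ∈ grid d M n), fun θ => ?_, ?_⟩
  · rw [Finset.mem_filter, and_iff_right_iff_imp]
    rintro ⟨⟨i, hi1, hi2, hi3⟩, h⟩
    choose k hk1 hk2 hk3 using h
    have hin : i < n + 1 := by
      rw [Nat.lt_succ_iff]
      have : (i : ℝ) ^ 2 ≤ n := (Real.le_sqrt (by positivity) (by positivity)).1 hi2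
      have : i ^ 2 ≤ n := by exact_mod_cast this
      nlinarith
    have hkL : ∀ j, k j < L + 1 := fun j => Nat.lt_succ_iff.2 (Nat.le_floor (hk2 j))
    refine Finset.mem_image.2 ⟨(⟨i, hin⟩, fun j => (⟨k j, hkL j⟩,
      decide (θ.2 j = k j / √(n : ℝ)))), Finset.mem_univ _, ?_⟩
    refine Prod.ext hi3.symm (PiLp.ext fun j => ?_)
    by_cases hj : θ.2 j = k j / √(n : ℝ)
    · simp [F, hj]
    · simpa [F, hj] using ((hk3 j).resolve_left hj).symm
  · refine (Finset.card_filter_le _ _).trans (Finset.card_image_le.trans ?_)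
    simp

lemma log_card_bound_le {d : ℕ} {M : ℝ} (hM : 0 < M) {n : ℕ} (hn : 2 ≤ n) :
    Real.log (((n + 1) * ((⌊M * √(n : ℝ)⌋₊ + 1) * 2) ^ d : ℕ) : ℝ) ≤
      (2 + d * (Real.log (2 * (M + 1)) / Real.log 2 + 1)) * Real.log n := by
  have hn' : (2 : ℝ) ≤ n := by exact_mod_cast hn
  have h2 : 0 < Real.log 2 := Real.log_pos one_lt_two
  have hl : Real.log 2 ≤ Real.log n := Real.log_le_log two_pos hn'
  push_cast
  rw [Real.log_mul (by positivity) (by positivity), Real.log_pow]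
  have a1 : Real.log ((n : ℝ) + 1) ≤ 2 * Real.log n := by
    have := Real.log_le_log (by positivity) (by nlinarith : (n : ℝ) + 1 ≤ n ^ 2)
    rwa [Real.log_pow] at this
  have hsq : √(n : ℝ) ≤ n := (Real.sqrt_le_left (by positivity)).2 (by nlinarith)
  have hfl : (⌊M * √(n : ℝ)⌋₊ : ℝ) ≤ M * √(n : ℝ) := Nat.floor_le (by positivity)
  have a2 : Real.log (((⌊M * √(n : ℝ)⌋₊ : ℝ) + 1) * 2) ≤
      (Real.log (2 * (M + 1)) / Real.log 2 + 1) * Real.log n := by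
    have h3 : ((⌊M * √(n : ℝ)⌋₊ : ℝ) + 1) * 2 ≤ 2 * (M + 1) * n := by
      have := mul_le_mul_of_nonneg_left hsq hM.le
      nlinarith
    have h4 := Real.log_le_log (by positivity) h3
    rw [Real.log_mul (x := 2 * (M + 1)) (by positivity) (by positivity)] at h4
    have h5 : Real.log (2 * (M + 1)) ≤ Real.log (2 * (M + 1)) / Real.log 2 * Real.log n := by
      rw [div_mul_eq_mul_div, le_div_iff₀ h2]
      gcongr
      exact Real.log_nonneg (by linarith)
    linarith
  have := mul_le_mul_of_nonneg_left a2 (Nat.cast_nonneg (α := ℝ) d)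
  linarith

/-! ### An oracle inequality for minimum contrast estimators over a finite set -/

section Oracle

variable {𝓧 : Type*} [MeasurableSpace 𝓧] {P : Measure 𝓧}

/-- The centred empirical mean of `h` along the sample `X`. -/
noncomputable def empiricalProcess (P : Measure 𝓧) {n : ℕ} (X : Fin n → 𝓧) (h : 𝓧 → ℝ) : ℝ :=
  (1 / (n : ℝ)) * ∑ i, h (X i) - ∫ x, h x ∂P

lemma exp_mul_empiricalProcess {n : ℕ} (hn : 0 < n) (t : ℝ) (h : 𝓧 → ℝ) (X : Fin n → 𝓧) :
    Real.exp (n * t * empiricalProcess P X h) =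
      ∏ i, Real.exp (t * (h (X i) - ∫ x, h x ∂P)) := by
  rw [← Real.exp_sum, ← Finset.mul_sum, Finset.sum_sub_distrib]
  congr 1
  have : (n : ℝ) ≠ 0 := by positivity
  simp only [empiricalProcess, Finset.sum_const, Finset.card_univ, Fintype.card_fin, nsmul_eq_mul]
  field_simp

variable [IsProbabilityMeasure P]

/-- Integrate `exp u ≤ 1 + u + u ^ 2`, valid for `|u| ≤ 1`: the centred linear term vanishes and the
variance is at most the second moment. -/
lemma integral_exp_mul_sub_integral_le {h : 𝓧 → ℝ} {b t : ℝ} (hm : AEStronglyMeasurable h P)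
    (hb : ∀ x, |h x| ≤ b) (ht : |t| * (2 * b) ≤ 1) :
    ∫ x, Real.exp (t * (h x - ∫ y, h y ∂P)) ∂P ≤ Real.exp (t ^ 2 * ∫ x, h x ^ 2 ∂P) := by
  set m := ∫ y, h y ∂P with hmdef
  have hi : Integrable h P := .of_bound hm b (.of_forall hb)
  have hi2 : Integrable (fun x => h x ^ 2) P := by
    refine .of_bound (hm.pow 2) (b ^ 2) (.of_forall fun x => ?_)
    rw [Real.norm_eq_abs, abs_pow]
    exact pow_le_pow_left₀ (abs_nonneg _) (hb x) 2
  have hmb : |m| ≤ b := by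
    have := norm_integral_le_of_norm_le_const (μ := P) (f := h) (C := b) (.of_forall hb)
    simpa using this
  have hu : ∀ x, |t * (h x - m)| ≤ 1 := fun x => by
    rw [abs_mul]
    have := abs_sub (h x) m
    have := hb x
    exact (mul_le_mul_of_nonneg_left (by linarith) (abs_nonneg t)).trans ht
  have hie : Integrable (fun x => Real.exp (t * (h x - m))) P := by
    refine .of_bound (Real.continuous_exp.comp_aestronglyMeasurable
      ((hm.sub aestronglyMeasurable_const).const_mul t)) (Real.exp 1) (.of_forall fun x => ?_)
    rw [Real.norm_eq_abs, Real.abs_exp]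
    exact Real.exp_le_exp.2 ((le_abs_self _).trans (hu x))
  have hq : Integrable (fun x => (1 + t * (h x - m)) + t ^ 2 * (h x - m) ^ 2) P := by
    have h1 : Integrable (fun x => (h x - m) ^ 2) P := by
      have e : (fun x => (h x - m) ^ 2) = fun x => (h x ^ 2 - 2 * m * h x) + m ^ 2 := by
        ext x; ring
      rw [e]
      exact (hi2.sub (hi.const_mul _)).add (integrable_const _)
    exact ((integrable_const _).add ((hi.sub (integrable_const _)).const_mul _)).add
      (h1.const_mul _)
  calc ∫ x, Real.exp (t * (h x - m)) ∂P
      ≤ ∫ x, ((1 + t * (h x - m)) + t ^ 2 * (h x - m) ^ 2) ∂P := by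
        refine integral_mono hie hq fun x => ?_
        have := (abs_le.1 (Real.abs_exp_sub_one_sub_id_le (hu x))).2
        simp only
        nlinarith
    _ = 1 + t ^ 2 * (∫ x, h x ^ 2 ∂P) - t ^ 2 * m ^ 2 := by
        have e : ∀ x, (1 + t * (h x - m)) + t ^ 2 * (h x - m) ^ 2 =
            (t ^ 2 * h x ^ 2 + (t - 2 * t ^ 2 * m) * h x) + (1 - t * m + t ^ 2 * m ^ 2) :=
          fun x => by ring
        simp_rw [e]
        have i1 : Integrable (fun x => t ^ 2 * h x ^ 2 + (t - 2 * t ^ 2 * m) * h x) P :=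
          (hi2.const_mul _).add (hi.const_mul _)
        rw [integral_add i1 (integrable_const _), integral_add (hi2.const_mul _) (hi.const_mul _),
          integral_const_mul, integral_const_mul, ← hmdef]
        simp
        ring
    _ ≤ t ^ 2 * (∫ x, h x ^ 2 ∂P) + 1 := by nlinarith [mul_nonneg (sq_nonneg t) (sq_nonneg m)]
    _ ≤ _ := Real.add_one_le_exp _

lemma integrable_exp_mul_empiricalProcess {n : ℕ} (hn : 0 < n) {t b : ℝ} {h : 𝓧 → ℝ}
    (hm : AEStronglyMeasurable h P) (hb : ∀ x, |h x| ≤ b) :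
    Integrable (fun X : Fin n → 𝓧 => Real.exp (n * t * empiricalProcess P X h))
      (Measure.pi fun _ => P) := by
  simp_rw [exp_mul_empiricalProcess hn]
  refine Integrable.fintype_prod (f := fun _ x => Real.exp (t * (h x - ∫ x, h x ∂P))) fun _ => ?_
  refine .of_bound (Real.continuous_exp.comp_aestronglyMeasurable
      ((hm.sub aestronglyMeasurable_const).const_mul t))
      (Real.exp (|t| * (b + |∫ x, h x ∂P|))) (.of_forall fun x => ?_)
  rw [Real.norm_eq_abs, Real.abs_exp]
  refine Real.exp_le_exp.2 ((le_abs_self _).trans ?_)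
  rw [abs_mul]
  gcongr
  exact (abs_sub _ _).trans (by gcongr; exact hb x)

lemma integral_exp_mul_empiricalProcess_le {n : ℕ} (hn : 0 < n) {t b : ℝ} {h : 𝓧 → ℝ}
    (hm : AEStronglyMeasurable h P) (hb : ∀ x, |h x| ≤ b) (ht : |t| * (2 * b) ≤ 1) :
    ∫ X : Fin n → 𝓧, Real.exp (n * t * empiricalProcess P X h) ∂(Measure.pi fun _ => P) ≤
      Real.exp (n * (t ^ 2 * ∫ x, h x ^ 2 ∂P)) := by
  simp_rw [exp_mul_empiricalProcess hn]
  rw [integral_fintype_prod_eq_pow (fun x => Real.exp (t * (h x - ∫ x, h x ∂P))),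
    Fintype.card_fin, Real.exp_nat_mul]
  exact pow_le_pow_left₀ (integral_nonneg fun x => (Real.exp_pos _).le)
    (integral_exp_mul_sub_integral_le hm hb ht) n

lemma integrable_empiricalProcess {n : ℕ} {h : 𝓧 → ℝ} (hi : Integrable h P) :
    Integrable (fun X : Fin n → 𝓧 => empiricalProcess P X h) (Measure.pi fun _ => P) :=
  ((integrable_finsetSum _ fun i _ => integrable_comp_eval (i := i) hi).const_mul _).sub
    (integrable_const _)

lemma integral_empiricalProcess {n : ℕ} (hn : 0 < n) {h : 𝓧 → ℝ} (hi : Integrable h P) :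
    ∫ X : Fin n → 𝓧, empiricalProcess P X h ∂(Measure.pi fun _ => P) = 0 := by
  have he : ∀ i : Fin n, Integrable (fun X : Fin n → 𝓧 => h (X i)) (Measure.pi fun _ => P) :=
    fun i => integrable_comp_eval (i := i) hi
  simp only [empiricalProcess]
  rw [integral_sub ((integrable_finsetSum _ fun i _ => he i).const_mul _) (integrable_const _),
    integral_const_mul, integral_finsetSum _ fun i _ => he i]
  have : ∀ i : Fin n, ∫ X : Fin n → 𝓧, h (X i) ∂(Measure.pi fun _ => P) = ∫ x, h x ∂P := fun i =>
    integral_comp_eval (μ := fun _ : Fin n => P) (i := i) hi.1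
  simp_rw [this]
  have : (n : ℝ) ≠ 0 := by positivity
  simp
  field_simp
  simp

/-- The tangent line of `exp` at `0`, evaluated at `x - log N`. It serves as a maximal inequality:
when `N` exponentials each have mean at most one, the last two terms of the bound cancel on average,
leaving `log N`. -/
lemma le_log_add_exp_div_sub_one {N : ℝ} (hN : 0 < N) (x : ℝ) :
    x ≤ Real.log N + Real.exp x / N - 1 := by
  have := Real.add_one_le_exp (x - Real.log N)
  rw [Real.exp_sub, Real.exp_log hN] at this
  linarith

/-- Oracle inequality: `D i` is the loss of the index `i`, and `T` is at least as good as the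
index `i₀` for the empirical version of the loss. -/
theorem lintegral_loss_le {ι : Type*} {n : ℕ} (hn : 0 < n) (S : Finset ι) {h : ι → 𝓧 → ℝ}
    {D : ι → ℝ} {B N : ℝ} (hB : 0 < B) (hSN : S.card ≤ N)
    (hm : ∀ i, Measurable (h i)) (hb : ∀ i ∈ S, ∀ x, |h i x| ≤ B) (hD : ∀ i, 0 ≤ D i)
    (hvar : ∀ i ∈ S, ∫ x, h i x ^ 2 ∂P ≤ B * D i) {i₀ : ι} (hi₀ : i₀ ∈ S)
    {T : (Fin n → 𝓧) → ι} (hTS : ∀ X, T X ∈ S)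
    (hT : ∀ X, D (T X) - 2 * empiricalProcess P X (h (T X)) ≤
      D i₀ - 2 * empiricalProcess P X (h i₀)) :
    ∫⁻ X, ENNReal.ofReal (D (T X)) ∂(Measure.pi fun _ => P) ≤
      ENNReal.ofReal (2 * D i₀ + 16 * B / n * Real.log N) := by
  have hn' : (0 : ℝ) < n := by positivity
  have hN : 0 < N := lt_of_lt_of_le (by exact_mod_cast Finset.card_pos.2 ⟨i₀, hi₀⟩) hSN
  -- With `t * B = 1/4`, the variance bound gives `t ^ 2 * (B * D i) = t / 4 * D i`, exactly the
  -- penalty in `E`.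
  set t := 1 / (4 * B) with ht
  have ht0 : 0 < t := by positivity
  have htB : t * B = 1 / 4 := by rw [ht]; field_simp
  -- exponential moments of the penalised empirical process
  set E : ι → (Fin n → 𝓧) → ℝ := fun i X =>
    Real.exp (n * t * empiricalProcess P X (h i)) * Real.exp (-(n * (t / 4 * D i))) with hE
  have hEint : ∀ i ∈ S, Integrable (E i) (Measure.pi fun _ => P) := fun i hi =>
    (integrable_exp_mul_empiricalProcess hn (hm i).aestronglyMeasurable (hb i hi)).mul_const _
  have hE1 : ∀ i ∈ S, ∫ X, E i X ∂(Measure.pi fun _ => P) ≤ 1 := fun i hi => by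
    rw [integral_mul_const]
    have h1 := integral_exp_mul_empiricalProcess_le (P := P) hn (t := t) (hm i).aestronglyMeasurable
      (hb i hi) (by rw [abs_of_pos ht0]; linarith)
    calc _ ≤ Real.exp (n * (t ^ 2 * ∫ x, h i x ^ 2 ∂P)) * Real.exp (-(n * (t / 4 * D i))) := by
          gcongr
      _ ≤ 1 := by
          rw [← Real.exp_add, Real.exp_le_one_iff]
          have h2 : t ^ 2 * ∫ x, h i x ^ 2 ∂P ≤ t / 4 * D i := by
            calc t ^ 2 * ∫ x, h i x ^ 2 ∂P ≤ t ^ 2 * (B * D i) := by gcongr; exact hvar i hi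
              _ = t * (t * B) * D i := by ring
              _ = _ := by rw [htB]; ring
          nlinarith [mul_le_mul_of_nonneg_left h2 hn'.le]
  set G : (Fin n → 𝓧) → ℝ := fun X => (2 * D i₀ - 4 * empiricalProcess P X (h i₀)) +
    16 * B / n * ((Real.log N - 1) + (∑ i ∈ S, E i X) / N) with hG
  have hi₀int : Integrable (h i₀) P :=
    .of_bound (hm i₀).aestronglyMeasurable B (.of_forall (hb i₀ hi₀))
  have hg1 : Integrable (fun X => 2 * D i₀ - 4 * empiricalProcess P X (h i₀))
      (Measure.pi fun _ : Fin n => P) :=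
    (integrable_const _).sub ((integrable_empiricalProcess hi₀int).const_mul _)
  have hsum : Integrable (fun X => (∑ i ∈ S, E i X) / N) (Measure.pi fun _ : Fin n => P) :=
    (integrable_finsetSum _ hEint).div_const _
  have hg2 : Integrable (fun X => (Real.log N - 1) + (∑ i ∈ S, E i X) / N)
      (Measure.pi fun _ : Fin n => P) := (integrable_const _).add hsum
  have hGint : Integrable G (Measure.pi fun _ => P) := hg1.add (hg2.const_mul _)
  have hpt : ∀ X, D (T X) ≤ G X := by
    intro X
    have h1 := le_log_add_exp_div_sub_one hN
      (n * t * empiricalProcess P X (h (T X)) + -(n * (t / 4 * D (T X))))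
    rw [Real.exp_add] at h1
    have h2 : E (T X) X ≤ ∑ i ∈ S, E i X :=
      Finset.single_le_sum (f := fun i => E i X) (fun i _ => by positivity) (hTS X)
    have h3 : n * t * empiricalProcess P X (h (T X)) + -(n * (t / 4 * D (T X))) ≤
        (Real.log N - 1) + (∑ i ∈ S, E i X) / N := by
      have : E (T X) X / N ≤ (∑ i ∈ S, E i X) / N := by gcongr
      linarith
    -- The factor is `4 / (n t)`, which turns the exponent into `4 ν - D`, with `ν` the empirical
    -- process at `T X`. Added to twice `hT`, it removes `ν` and leaves one copy of `D (T X)`.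
    have h4 := mul_le_mul_of_nonneg_left h3 (by positivity : 0 ≤ 16 * B / n)
    have h5 : 16 * B / n * (n * t * empiricalProcess P X (h (T X)) +
        -(n * (t / 4 * D (T X)))) = 4 * empiricalProcess P X (h (T X)) - D (T X) := by
      rw [ht]; field_simp; ring
    rw [h5] at h4
    have := hT X
    simp only [hG]
    linarith
  calc ∫⁻ X, ENNReal.ofReal (D (T X)) ∂(Measure.pi fun _ => P)
      ≤ ∫⁻ X, ENNReal.ofReal (G X) ∂(Measure.pi fun _ => P) :=
        lintegral_mono fun X => ENNReal.ofReal_le_ofReal (hpt X)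
    _ = ENNReal.ofReal (∫ X, G X ∂(Measure.pi fun _ => P)) :=
        (ofReal_integral_eq_lintegral_ofReal hGint
          (.of_forall fun X => (hD _).trans (hpt X))).symm
    _ ≤ _ := by
        refine ENNReal.ofReal_le_ofReal ?_
        rw [integral_add hg1 (hg2.const_mul _), integral_const_mul,
          integral_add (integrable_const _) hsum, integral_div, integral_finsetSum _ hEint,
          integral_sub (integrable_const _) ((integrable_empiricalProcess hi₀int).const_mul _),
          integral_const_mul 4, integral_empiricalProcess hn hi₀int]
        have h1 : (∑ i ∈ S, ∫ X, E i X ∂(Measure.pi fun _ => P)) / N ≤ 1 := by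
          rw [div_le_one hN]
          refine (Finset.sum_le_sum hE1).trans ?_
          simpa using hSN
        simp only [integral_const, probReal_univ, one_smul, mul_zero, sub_zero]
        gcongr
        linarith

end Oracle

/-! ### The grid estimator -/

section Mixture

variable {d : ℕ} {φ : Eucl d → ℝ}

lemma measurable_mixture (h : Measurable φ) (θ : ℝ × Eucl d) : Measurable (mixture φ θ) := by
  unfold mixture; fun_prop

lemma mixture_nonneg (h : ∀ x, 0 ≤ φ x) {θ : ℝ × Eucl d} (hθ : θ.1 ∈ Set.Icc (0 : ℝ) 1)
    (x : Eucl d) : 0 ≤ mixture φ θ x :=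
  add_nonneg (mul_nonneg (sub_nonneg.2 hθ.2) (h _)) (mul_nonneg hθ.1 (h _))

lemma mixture_le {B : ℝ} (h : ∀ x, φ x ≤ B) {θ : ℝ × Eucl d} (hθ : θ.1 ∈ Set.Icc (0 : ℝ) 1)
    (x : Eucl d) : mixture φ θ x ≤ B := by
  have h1 := mul_le_mul_of_nonneg_left (h x) (sub_nonneg.2 hθ.2)
  have h2 := mul_le_mul_of_nonneg_left (h (x - θ.2)) hθ.1
  unfold mixture
  linarith

lemma integrable_mixture (h : Integrable φ) (θ : ℝ × Eucl d) : Integrable (mixture φ θ) :=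
  memLp_one_iff_integrable.1 (memLp_mixture (memLp_one_iff_integrable.2 h) θ)

lemma integral_mixture (h : Integrable φ) (θ : ℝ × Eucl d) :
    ∫ x, mixture φ θ x = ∫ x, φ x := by
  simp only [mixture]
  rw [integral_add (h.const_mul _) ((h.comp_sub_right θ.2).const_mul _), integral_const_mul,
    integral_const_mul, integral_sub_right_eq_self φ θ.2]
  ring

/-- The law with density `mixture φ θ`. -/
noncomputable def mixtureLaw (φ : Eucl d → ℝ) (θ : ℝ × Eucl d) : Measure (Eucl d) :=
  volume.withDensity fun x => ENNReal.ofReal (mixture φ θ x)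

lemma isProbabilityMeasure_mixtureLaw (hφ : IsDensity φ) {θ : ℝ × Eucl d}
    (hθ : θ.1 ∈ Set.Icc (0 : ℝ) 1) : IsProbabilityMeasure (mixtureLaw φ θ) := by
  refine ⟨?_⟩
  rw [mixtureLaw, withDensity_apply _ MeasurableSet.univ, Measure.restrict_univ,
    ← ofReal_integral_eq_lintegral_ofReal (integrable_mixture hφ.integrable θ)
      (.of_forall (mixture_nonneg hφ.nonneg hθ)),
    integral_mixture hφ.integrable, hφ.integral_eq_one, ENNReal.ofReal_one]

lemma integral_mixtureLaw (hφ : ∀ x, 0 ≤ φ x) (hm : Measurable φ) {θ : ℝ × Eucl d}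
    (hθ : θ.1 ∈ Set.Icc (0 : ℝ) 1) (f : Eucl d → ℝ) :
    ∫ x, f x ∂(mixtureLaw φ θ) = ∫ x, mixture φ θ x * f x := by
  rw [mixtureLaw, integral_withDensity_eq_integral_toReal_smul
    (measurable_mixture hm θ).ennreal_ofReal (.of_forall fun _ => ENNReal.ofReal_lt_top)]
  simp_rw [ENNReal.toReal_ofReal (mixture_nonneg hφ hθ _), smul_eq_mul]

/-- The cross term of the expanded square is the mean of `mixture φ θ` under the true law, so it
cancels against the centring of the empirical process. What remains besides the contrast is free of
`θ`. -/
lemma integral_mixture_sub_sq_sub_empiricalProcess (hφ : ∀ x, 0 ≤ φ x) (hm : Measurable φ)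
    (h2 : MemLp φ 2) {n : ℕ} (X : Fin n → Eucl d) {θ' : ℝ × Eucl d}
    (hθ' : θ'.1 ∈ Set.Icc (0 : ℝ) 1) (θ : ℝ × Eucl d) :
    (∫ x, (mixture φ θ x - mixture φ θ' x) ^ 2) -
      2 * empiricalProcess (mixtureLaw φ θ') X (fun x => mixture φ θ x - mixture φ θ' x) =
    contrast φ n X θ + (2 / n * (∑ i, mixture φ θ' (X i)) - ∫ x, mixture φ θ' x ^ 2) := by
  have i1 := (memLp_mixture h2 θ).integrable_sq
  have i2 := (memLp_mixture h2 θ').integrable_sq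
  have i3 : Integrable fun x => mixture φ θ' x * mixture φ θ x :=
    (memLp_mixture h2 θ').integrable_mul (memLp_mixture h2 θ)
  have e1 : ∫ x, (mixture φ θ x - mixture φ θ' x) ^ 2 = (∫ x, mixture φ θ x ^ 2) -
      2 * (∫ x, mixture φ θ' x * mixture φ θ x) + ∫ x, mixture φ θ' x ^ 2 := by
    have i4 : Integrable fun x => mixture φ θ x ^ 2 - 2 * (mixture φ θ' x * mixture φ θ x) :=
      i1.sub (i3.const_mul _)
    rw [← integral_const_mul, ← integral_sub i1 (i3.const_mul _), ← integral_add i4 i2]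
    congr 1
    ext x
    ring
  have e2 : ∫ x, mixture φ θ' x * (mixture φ θ x - mixture φ θ' x) =
      (∫ x, mixture φ θ' x * mixture φ θ x) - ∫ x, mixture φ θ' x ^ 2 := by
    rw [← integral_sub i3 i2]
    congr 1
    ext x
    ring
  rw [empiricalProcess, integral_mixtureLaw hφ hm hθ', e1, e2, contrast, Finset.sum_sub_distrib]
  ring

lemma mem_Icc_of_mem_grid {M : ℝ} {n : ℕ} {θ : ℝ × Eucl d} (h : θ ∈ grid d M n) :
    θ.1 ∈ Set.Icc (0 : ℝ) 1 := by
  obtain ⟨⟨i, -, h2, h3⟩, -⟩ := h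
  rw [h3]
  exact ⟨by positivity, div_le_one_of_le₀ h2 (by positivity)⟩

lemma mem_cube_of_mem_grid {M : ℝ} {n : ℕ} {θ : ℝ × Eucl d} (h : θ ∈ grid d M n) :
    θ.2 ∈ cube d M := by
  intro j
  obtain ⟨k, h1, h2, h3⟩ := h.2 j
  have habs : |θ.2 j| = k / √(n : ℝ) := by
    rcases h3 with h3 | h3 <;> rw [h3]
    · exact abs_of_nonneg (by positivity)
    · rw [abs_neg]; exact abs_of_nonneg (by positivity)
  rw [habs]
  rcases (Real.sqrt_nonneg (n : ℝ)).eq_or_lt with h0 | h0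
  · rw [← h0, mul_zero] at h2
    have : (1 : ℝ) ≤ k := by exact_mod_cast h1
    linarith
  · exact (div_le_iff₀ h0).2 h2

/-- The `L²` risk of a grid estimator is at most of order `log n / n`. -/
theorem exists_lintegral_integral_mixture_sub_sq_le {M : ℝ} (hM : 0 < M) (hφ : IsDensity φ)
    (hm : Measurable φ) (h2 : MemLp φ 2) {g : Eucl d → ℝ} (hg : MemLp g 2)
    (hlip : ∀ x : Eucl d, ∀ μ ∈ cube d M, |φ x - φ (x - μ)| ≤ ‖μ‖ * g x) :
    ∃ C > 0, ∀ n : ℕ, 2 ≤ n → 1 ≤ M * √(n : ℝ) →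
      ∀ T : (Fin n → Eucl d) → ℝ × Eucl d, IsGridEstimator φ M n T →
      ∀ θ : ℝ × Eucl d, θ.1 ∈ Set.Icc (0 : ℝ) 1 → θ.2 ∈ cube d M →
        ∫⁻ X, ENNReal.ofReal (∫ x, (mixture φ (T X) x - mixture φ θ x) ^ 2) ∂(sampleLaw φ n θ) ≤
          ENNReal.ofReal (C * (Real.log n / n)) := by
  obtain ⟨B, hB, hφB⟩ := exists_forall_le_of_lipschitz hM hφ.nonneg h2 hg hlip
  set A := 8 * (∫ x, φ x ^ 2) + 2 * (d * ∫ x, g x ^ 2) with hA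
  have hA0 : 0 ≤ A := by
    have : 0 ≤ ∫ x, φ x ^ 2 := integral_nonneg fun x => sq_nonneg _
    have : 0 ≤ ∫ x, g x ^ 2 := integral_nonneg fun x => sq_nonneg _
    positivity
  set L := 2 + d * (Real.log (2 * (M + 1)) / Real.log 2 + 1) with hL
  have hlog2 : 0 < Real.log 2 := Real.log_pos one_lt_two
  have hL0 : 0 < L := by
    have : 0 ≤ Real.log (2 * (M + 1)) := Real.log_nonneg (by linarith)
    positivity
  refine ⟨2 * A / Real.log 2 + 16 * B * L, by positivity, fun n hn hMn T hT θ hθ1 hθ2 => ?_⟩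
  have hn0 : 0 < n := by omega
  have hn' : (0 : ℝ) < n := by exact_mod_cast hn0
  have := isProbabilityMeasure_mixtureLaw hφ hθ1
  obtain ⟨S, hS, hScard⟩ := exists_finset_eq_grid d M n
  obtain ⟨θ₀, hθ₀, hθ₀1, hθ₀2⟩ := exists_mem_grid_abs_sub_le hn0 hMn hθ1 hθ2
  have hs : 0 < √(n : ℝ) := Real.sqrt_pos.2 hn'
  have hinv : (1 / √(n : ℝ)) ^ 2 = 1 / n := by rw [div_pow, one_pow, Real.sq_sqrt hn'.le]
  have hD₀ : ∫ x, (mixture φ θ₀ x - mixture φ θ x) ^ 2 ≤ A / n := by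
    have hcube : θ₀.2 - θ.2 ∈ cube d M := fun j =>
      (hθ₀2 j).trans ((div_le_iff₀ hs).2 hMn)
    refine (integral_mixture_sub_sq_le h2 hg hlip
      (by rw [abs_of_nonneg hθ1.1]; exact hθ1.2) hcube).trans ?_
    have h3 : (θ₀.1 - θ.1) ^ 2 ≤ 1 / n := by
      rw [← hinv, ← sq_abs]; gcongr
    have h4 : ‖θ₀.2 - θ.2‖ ^ 2 ≤ d * (1 / n) := by
      rw [← hinv]; exact norm_sq_le_of_abs_apply_le hθ₀2
    have i1 : 0 ≤ ∫ x, φ x ^ 2 := integral_nonneg fun x => sq_nonneg _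
    have i2 : 0 ≤ ∫ x, g x ^ 2 := integral_nonneg fun x => sq_nonneg _
    calc _ ≤ 8 * (1 / (n : ℝ)) * (∫ x, φ x ^ 2) + 2 * (d * (1 / n) * ∫ x, g x ^ 2) := by gcongr
      _ = A / n := by rw [hA]; ring
  have hrisk := lintegral_loss_le (P := mixtureLaw φ θ) hn0 S
    (h := fun τ x => mixture φ τ x - mixture φ θ x)
    (D := fun τ => ∫ x, (mixture φ τ x - mixture φ θ x) ^ 2) hB (Nat.cast_le.2 hScard)
    (fun τ => (measurable_mixture hm τ).sub (measurable_mixture hm θ))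
    (fun τ hτ x => by
      have hτ' := mem_Icc_of_mem_grid ((hS τ).1 hτ)
      have := mixture_nonneg hφ.nonneg hτ' x
      have := mixture_nonneg hφ.nonneg hθ1 x
      have := mixture_le hφB hτ' x
      have := mixture_le hφB hθ1 x
      rw [abs_le]; constructor <;> linarith)
    (fun τ => integral_nonneg fun x => sq_nonneg _)
    -- The true density is at most `B`, so a second moment under its law is at most `B` times the
    -- Lebesgue one.
    (fun τ _ => by
      rw [integral_mixtureLaw hφ.nonneg hm hθ1, ← integral_const_mul]
      have hi : Integrable fun x => (mixture φ τ x - mixture φ θ x) ^ 2 :=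
        ((memLp_mixture h2 τ).sub (memLp_mixture h2 θ)).integrable_sq
      refine integral_mono_of_nonneg (.of_forall fun x =>
        mul_nonneg (mixture_nonneg hφ.nonneg hθ1 x) (sq_nonneg _)) (hi.const_mul B)
        (.of_forall fun x => ?_)
      exact mul_le_mul_of_nonneg_right (mixture_le hφB hθ1 x) (sq_nonneg _))
    ((hS θ₀).2 hθ₀) (T := T) (fun X => (hS _).2 (hT.mem_grid X))
    (fun X => by
      rw [integral_mixture_sub_sq_sub_empiricalProcess hφ.nonneg hm h2 X hθ1,
        integral_mixture_sub_sq_sub_empiricalProcess hφ.nonneg hm h2 X hθ1]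
      have := hT.minimizes X θ₀ hθ₀
      linarith)
  refine hrisk.trans (ENNReal.ofReal_le_ofReal ?_)
  have hl : Real.log 2 ≤ Real.log n := Real.log_le_log two_pos (by exact_mod_cast hn)
  calc _ ≤ 2 * (A / n) + 16 * B / n * (L * Real.log n) := by
        gcongr
        exact log_card_bound_le hM hn
    _ = 2 * (A * 1) / n + 16 * B * L * (Real.log n / n) := by ring
    _ ≤ 2 * (A * (Real.log n / Real.log 2)) / n + 16 * B * L * (Real.log n / n) := by
        gcongr
        rwa [one_le_div hlog2]
    _ = _ := by ring

end Mixture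

/-! ### From `L²` risk to location risk -/

theorem mainTheorem1 (d : ℕ) (M : ℝ) (hM : 0 < M) (φ : Eucl d → ℝ)
    (hφ : IsDensity φ) (hS : AssumptionHS φ) (hLip : AssumptionHLip M φ) :
    ∃ C₁ : ℝ, 0 < C₁ ∧ ∀ n : ℕ, 2 ≤ n →
      ∀ T : (Fin n → Eucl d) → ℝ × Eucl d, IsGridEstimator φ M n T →
        (⨆ θ ∈ Set.Ioo (0 : ℝ) 1 ×ˢ cube d M,
          ∫⁻ X, ENNReal.ofReal ((θ.1 * ‖θ.2‖) ^ 2 * ‖(T X).2 - θ.2‖ ^ 2) ∂(sampleLaw φ n θ))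
        ≤ ENNReal.ofReal (C₁ * Real.log n ^ 2 / n) := by
  obtain ⟨g, hg, hlip, -⟩ := hLip
  have hm : Measurable φ := hS.contDiff.continuous.measurable
  obtain ⟨C, hC, hrisk⟩ := exists_lintegral_integral_mixture_sub_sq_le hM hφ hm hS.memLp hg hlip
  have hlog2 : 0 < Real.log 2 := Real.log_pos one_lt_two
  -- The summand `1` keeps `R` positive when `d = 0`.
  set R := M * √(d : ℝ) + 1 with hR
  have hR0 : 0 < R := by positivity
  have hcube : ∀ v ∈ cube d M, ‖v‖ ≤ R := fun v hv => by
    have h1 := norm_sq_le_of_abs_apply_le hv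
    have h2 : ‖v‖ ≤ M * √(d : ℝ) := by
      refine abs_le_of_sq_le_sq' ?_ (by positivity) |>.2
      rw [mul_pow, Real.sq_sqrt (by positivity)]
      linarith
    linarith
  obtain ⟨c, hc, hsep⟩ := exists_mul_le_integral_mixture_sub_sq hφ.integrable hφ.integral_eq_one
    hS.memLp hR0
  refine ⟨C / c / Real.log 2, by positivity, fun n hn T hT => iSup₂_le fun θ hθ => ?_⟩
  rcases Nat.eq_zero_or_pos d with rfl | hd
  · have : θ.2 = 0 := Subsingleton.elim _ _
    simp [this]
  -- The estimator's value at any sample witnesses a nonempty grid; reading off the condition needs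
  -- a coordinate, so `d = 0` was treated apart.
  have hMn : 1 ≤ M * √(n : ℝ) := by
    obtain ⟨k, h1, h2, -⟩ := (hT.mem_grid fun _ => 0).2 ⟨0, hd⟩
    exact le_trans (by exact_mod_cast h1) h2
  have hl : Real.log 2 ≤ Real.log n := Real.log_le_log two_pos (by exact_mod_cast hn)
  calc ∫⁻ X, ENNReal.ofReal ((θ.1 * ‖θ.2‖) ^ 2 * ‖(T X).2 - θ.2‖ ^ 2) ∂(sampleLaw φ n θ)
      ≤ ∫⁻ X, ENNReal.ofReal (1 / c) *
          ENNReal.ofReal (∫ x, (mixture φ (T X) x - mixture φ θ x) ^ 2) ∂(sampleLaw φ n θ) := by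
        refine lintegral_mono fun X => ?_
        rw [← ENNReal.ofReal_mul (by positivity)]
        refine ENNReal.ofReal_le_ofReal ?_
        rw [one_div, inv_mul_eq_div, le_div_iff₀ hc, mul_comm]
        exact hsep _ _ (hcube _ (mem_cube_of_mem_grid (hT.mem_grid X))) (hcube _ hθ.2)
    _ = ENNReal.ofReal (1 / c) * ∫⁻ X, ENNReal.ofReal
          (∫ x, (mixture φ (T X) x - mixture φ θ x) ^ 2) ∂(sampleLaw φ n θ) :=
        lintegral_const_mul' _ _ ENNReal.ofReal_ne_top
    _ ≤ ENNReal.ofReal (1 / c) * ENNReal.ofReal (C * (Real.log n / n)) := by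
        gcongr
        exact hrisk n hn hMn T hT θ (Set.Ioo_subset_Icc_self hθ.1) hθ.2
    _ = ENNReal.ofReal (C / c / Real.log 2 * (Real.log 2 * Real.log n) / n) := by
        rw [← ENNReal.ofReal_mul (by positivity)]
        congr 1
        field_simp
    _ ≤ _ := by
        refine ENNReal.ofReal_le_ofReal ?_
        have : Real.log 2 * Real.log n ≤ Real.log n ^ 2 := by nlinarith
        gcongr
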